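/- Let $S^1=\mathbb R/2\pi\mathbb Z$, $L^2=L^2(S^1,d\theta/2\pi)$, $e_n(\theta)=e^{in\theta}$, and $\mathcal T_{\le N}=\mathrm{span}\{e_n:|n|\le N\}$. For a real weight $w\in W^{1,\infty}(S^1)$ with $0<w_-\le w\le w_+<\infty$ a.e. and for $\lambda>0$, put \[ \langle f,g\rangle_w=\int f\,\overline g\,w\,\frac{d\theta}{2\pi}\quad(f,g\in L^2),\qquad \langle f,g\rangle_{w,\lambda}=\langle f,g\rangle_w+\lambda\int f'\,\overline{g'}\,\frac{d\theta}{2\pi}\quad(f,g\in H^1(S^1)). \] Let $Q_N^{(0)}$ be the orthogonal projector of $L^2$ onto $\mathcal T_{\le N}$ with respect to $\langle\cdot,\cdot\rangle_w$, and let $Q_N^{(\lambda)}$ be the bounded operator on $L^2$ that extends the orthogonal projector of $H^1(S^1)$ onto $\mathcal T_{\le N}$ with respect to $\langle\cdot,\cdot\rangle_{w,\lambda}$. Let $(u_k^{(0)})_{k=1}^{2N+1}$ and $(u_k^{(\lambda)})_{k=1}^{2N+1}$ be the orthonormal bases of $\mathcal T_{\le N}$ obtained by Gram–Schmidt orthonormalization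 (with positive normalization factors) of the ordered basis $(e_{-N},\dots,e_N)$ with respect to $\langle\cdot,\cdot\rangle_w$ and $\langle\cdot,\cdot\rangle_{w,\lambda}$. Then, for every $N\ge 0$, there is a constant $C_N(w)>0$, depending only on $N$, $w_-$, $w_+$ and an upper bound for $\|w'\|_{L^\infty}$ (in particular not on $\lambda$), such that $Q_N^{(0)}$ and $Q_N^{(\lambda)}$ exist and are unique and \[ \|Q_N^{(\lambda)}-Q_N^{(0)}\|_{\mathcal B(L^2)}\le C_N(w)\,\lambda\qquad\text{for all }\lambda>0, \] and there is a unitary matrix $U_N\in U(2N+1)$, independent of $\lambda$, such that \[ \max_{1\le k\le 2N+1}\Big\|u_k^{(\lambda)}-\sum_{j=1}^{2N+1}(U_N)_{kj}\,u_j^{(0)}\Big\|_{L^2}\le C_N(w)\,\lambda \qquad\text{for all }\lambda>0. \] -/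

import Mathlib

open MeasureTheory Set
open scoped ENNReal ContDiff ComplexConjugate

namespace S1Model

instance twoPiPos : Fact (0 < 2 * Real.pi) := ⟨Real.two_pi_pos⟩

/-- The circle `ℝ / 2πℤ`. -/
abbrev S1 : Type := AddCircle (2 * Real.pi)

/-- The normalized measure `dθ / 2π` on the circle. -/
noncomputable abbrev μ₀ : Measure S1 := AddCircle.haarAddCircle

/-- The Hilbert space `L²(S¹, dθ/2π)`. -/
abbrev L2 : Type := Lp ℂ 2 μ₀

/-- The Fourier mode `e_n(θ) = exp(i n θ)` as an element of `L²`. -/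
noncomputable abbrev e (n : ℤ) : L2 := fourierLp (T := 2 * Real.pi) 2 n

/-- `w'` is the weak (distributional) derivative of `w` on the circle: integration by parts holds
against every smooth `2π`-periodic test function. -/
def IsWeakDeriv (w w' : S1 → ℝ) : Prop :=
  ∀ φ : ℝ → ℝ, ContDiff ℝ ∞ φ → Function.Periodic φ (2 * Real.pi) →
    ∫ θ in (0 : ℝ)..(2 * Real.pi), w (θ : S1) * deriv φ θ =
      -∫ θ in (0 : ℝ)..(2 * Real.pi), w' (θ : S1) * φ θ

/-- `w ∈ W^{1,∞}(S¹)`, with weak derivative `w'`. -/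
structure IsW1Infty (w w' : S1 → ℝ) : Prop where
  memLp : MemLp w ∞ μ₀
  memLp_deriv : MemLp w' ∞ μ₀
  isWeakDeriv : IsWeakDeriv w w'

/-- The Sobolev space `H¹(S¹)`: `∑ (1 + n²) |f̂(n)|² < ∞`. -/
def H1 : Set L2 :=
  {f | Summable fun n : ℤ => (1 + (n : ℝ) ^ 2) * ‖fourierCoeff (f : S1 → ℂ) n‖ ^ 2}

/-- The derivative `D = ∂_θ`, i.e. `D e_n = i n e_n`, given by `f' = ∑ i n f̂(n) e_n` (a series
converging in `L²` whenever `f ∈ H¹`; it is only used there). -/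
noncomputable def D (f : L2) : L2 :=
  ∑' n : ℤ, (Complex.I * (n : ℂ) * fourierCoeff (f : S1 → ℂ) n) • e n

/-- `⟨f, g⟩_w = ∫ f ḡ w dθ/2π`, on `L²`. -/
noncomputable def weightedForm (w : S1 → ℝ) (f g : L2) : ℂ :=
  ∫ θ, f θ * conj (g θ) * (w θ : ℂ) ∂μ₀

/-- `⟨f, g⟩_{w,lam} = ∫ f ḡ w dθ/2π + lam ∫ f' ḡ' dθ/2π`, on `H¹`. -/
noncomputable def sobolevForm (w : S1 → ℝ) (lam : ℝ) (f g : L2) : ℂ :=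
  weightedForm w f g + (lam : ℂ) * ∫ θ, D f θ * conj (D g θ) ∂μ₀

/-- Trigonometric polynomials of degree at most `N`. -/
noncomputable def trigPoly (N : ℕ) : Submodule ℂ L2 :=
  Submodule.span ℂ (e '' {n : ℤ | |n| ≤ N})

/-- The bounded operator `Q` on `L²` is the orthogonal projector onto `V` for the inner product `B`
with (dense) domain `dom`: `Q f ∈ V` and `f - Q f` is `B`-orthogonal to `V` for all `f` in `dom`.
When `dom` is smaller than `L²`, `Q` is the continuous extension to `L²` of the projector. -/
def IsOrthProjector (B : L2 → L2 → ℂ) (dom : Set L2) (V : Submodule ℂ L2) (Q : L2 →L[ℂ] L2) :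
    Prop :=
  ∀ f ∈ dom, Q f ∈ V ∧ ∀ g ∈ V, B (f - Q f) g = 0

/-- Gram–Schmidt orthogonalization of `v₀, …, v_{m-1}` for the inner product `B` (linear in the
first variable), before normalization:
`g_k = v_k - ∑_{j < k} (⟨v_k, g_j⟩ / ⟨g_j, g_j⟩) g_j`. -/
noncomputable def gramSchmidtAux (B : L2 → L2 → ℂ) {m : ℕ} (v : Fin m → L2) (k : Fin m) : L2 :=
  v k - ∑ j : Finset.Iio k,
    (B (v k) (gramSchmidtAux B v j) / B (gramSchmidtAux B v j) (gramSchmidtAux B v j)) •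
      gramSchmidtAux B v j
termination_by k
decreasing_by all_goals exact Fin.lt_def.1 (Finset.mem_Iio.1 j.2)

/-- The Gram–Schmidt orthonormalization `u_k = g_k / ⟨g_k, g_k⟩^{1/2}`. -/
noncomputable def gramSchmidtBasis (B : L2 → L2 → ℂ) {m : ℕ} (v : Fin m → L2) (k : Fin m) : L2 :=
  (((Real.sqrt (B (gramSchmidtAux B v k) (gramSchmidtAux B v k)).re)⁻¹ : ℝ) : ℂ) •
    gramSchmidtAux B v k

/-- The ordered basis `(e_{-N}, …, e_N)`. -/
noncomputable def modes (N : ℕ) (k : Fin (2 * N + 1)) : L2 := e ((k : ℕ) - (N : ℤ))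

end S1Model

/-!
On trigonometric polynomials the two inner products are `⟪g, T f⟫` and `⟪g, T' f⟫`, with `T`
multiplication by `w` and `T' = T + lam K`, where `K` is `-∂_θ²` compressed to degree at most `N`.
Since `⟨f', g'⟩ = ⟪g, K f⟫` for every `f ∈ H¹` as soon as `g` has degree at most `N`, the projector
for the Sobolev form is also governed by the bounded operator `T'`, and density of `H¹` extends its
orthogonality relations to all of `L²`.

Residuals of the projectors, and likewise the `k`-th unnormalized Gram–Schmidt vectors, come in
pairs `a`, `b` with `b - a` in a subspace to which `a` is `T`-orthogonal and `b` is `T'`-orthogonal.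
As `T'` is coercive with constant `w₋`, this gives `w₋ ‖b - a‖ ≤ ‖T' - T‖ ‖a‖ ≤ lam N² ‖a‖`. The
energies of `a` and `b` differ by `⟪a, (T' - T) b⟫`, so normalization preserves the estimate; the
bases are therefore close vector by vector, and the unitary matrix can be taken to be the identity.
-/

open scoped InnerProductSpace

namespace S1Model

section Coercive

variable {𝕜 E : Type*} [RCLike 𝕜] [NormedAddCommGroup E] [InnerProductSpace 𝕜 E]
  {c : ℝ} {T T' : E →L[𝕜] E} {V : Submodule 𝕜 E} {Q Q' : E →L[𝕜] E}

/-- Coercivity of the sesquilinear form `⟪f, T f⟫` with an explicit constant `c`, which may be zero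
or negative. -/
def IsCoerciveWith (c : ℝ) (T : E →L[𝕜] E) : Prop :=
  ∀ f, c * ‖f‖ ^ 2 ≤ RCLike.re ⟪f, T f⟫_𝕜

/-- `Q` is the projector onto `V` along the orthogonal complement of `V` for the form
`(f, g) ↦ ⟪g, T f⟫`. -/
def IsFormProjector (T : E →L[𝕜] E) (V : Submodule 𝕜 E) (Q : E →L[𝕜] E) : Prop :=
  ∀ f, Q f ∈ V ∧ ∀ g ∈ V, ⟪g, T (f - Q f)⟫_𝕜 = 0

/-- The multiple of `x` of unit energy `re ⟪x, T x⟫`, the normalization used in Gram–Schmidt for the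
form of `T`; it is `0` when the energy of `x` is not positive. -/
noncomputable def energyNormalize (T : E →L[𝕜] E) (x : E) : E :=
  (((√(RCLike.re ⟪x, T x⟫_𝕜))⁻¹ : ℝ) : 𝕜) • x

namespace IsCoerciveWith

theorem eq_zero_of_inner_eq_zero (hT : IsCoerciveWith c T) (hc : 0 < c) {f : E}
    (hf : ⟪f, T f⟫_𝕜 = 0) : f = 0 := by
  have h := hT f
  rw [hf, map_zero] at h
  have : ‖f‖ ^ 2 ≤ 0 := nonpos_of_mul_nonpos_right h hc
  simpa using this

theorem add_isPositive (hT : IsCoerciveWith c T) {K : E →L[𝕜] E} (hK : K.IsPositive) :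
    IsCoerciveWith c (T + K) := fun f => by
  rw [add_apply, inner_add_right, map_add]
  exact le_add_of_le_of_nonneg (hT f) (hK.re_inner_nonneg_right f)

theorem mul_norm_le_of_re_inner_le (hT : IsCoerciveWith c T) {x : E} {M : ℝ} (hM : 0 ≤ M)
    (h : RCLike.re ⟪x, T x⟫_𝕜 ≤ ‖x‖ * M) : c * ‖x‖ ≤ M := by
  rcases (norm_nonneg x).eq_or_lt with h0 | h0
  · simpa [← h0] using hM
  · refine le_of_mul_le_mul_left ?_ h0
    calc ‖x‖ * (c * ‖x‖) = c * ‖x‖ ^ 2 := by ring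
      _ ≤ ‖x‖ * M := (hT x).trans h

/-- Subtracting the two orthogonality relations gives `⟪b - a, T' (b - a)⟫ = -⟪b - a, (T' - T) a⟫`,
which coercivity of `T'` bounds from below. -/
theorem mul_norm_sub_le_of_orthogonal (hT' : IsCoerciveWith c T') {a b : E}
    (ha : ⟪b - a, T a⟫_𝕜 = 0) (hb : ⟪b - a, T' b⟫_𝕜 = 0) :
    c * ‖b - a‖ ≤ ‖T' - T‖ * ‖a‖ := by
  have energy_eq : ⟪b - a, T' (b - a)⟫_𝕜 = -⟪b - a, (T' - T) a⟫_𝕜 := by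
    rw [map_sub, inner_sub_right, hb, sub_apply, inner_sub_right, ha]
    ring
  refine hT'.mul_norm_le_of_re_inner_le (by positivity) ?_
  calc RCLike.re ⟪b - a, T' (b - a)⟫_𝕜 ≤ ‖⟪b - a, (T' - T) a⟫_𝕜‖ := by
        rw [energy_eq, ← norm_neg]
        exact RCLike.re_le_norm _
    _ ≤ ‖b - a‖ * ‖(T' - T) a‖ := norm_inner_le_norm _ _
    _ ≤ ‖b - a‖ * (‖T' - T‖ * ‖a‖) := by
        gcongr
        exact (T' - T).le_opNorm a

theorem sqrt_mul_norm_le (hT : IsCoerciveWith c T) (hc : 0 ≤ c) (x : E) :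
    √c * ‖x‖ ≤ √(RCLike.re ⟪x, T x⟫_𝕜) := by
  refine Real.le_sqrt_of_sq_le ?_
  rw [mul_pow, Real.sq_sqrt hc]
  exact hT x

theorem sqrt_mul_norm_energyNormalize_le (hT : IsCoerciveWith c T) (hc : 0 ≤ c) (x : E) :
    √c * ‖energyNormalize T x‖ ≤ 1 := by
  rw [energyNormalize, norm_smul, RCLike.norm_ofReal, abs_of_nonneg (by positivity),
    mul_left_comm]
  exact inv_mul_le_one_of_le₀ (hT.sqrt_mul_norm_le hc x) (Real.sqrt_nonneg _)

theorem sqrt_energy_smul_energyNormalize (hT : IsCoerciveWith c T) (hc : 0 < c) (x : E) :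
    ((√(RCLike.re ⟪x, T x⟫_𝕜) : ℝ) : 𝕜) • energyNormalize T x = x := by
  have norm_x_le := hT.sqrt_mul_norm_le hc.le x
  rw [energyNormalize, smul_smul, ← RCLike.ofReal_mul]
  rcases eq_or_ne (√(RCLike.re ⟪x, T x⟫_𝕜)) 0 with h0 | h0
  · rw [h0] at norm_x_le
    have hx : x = 0 :=
      norm_le_zero_iff.1 (nonpos_of_mul_nonpos_right norm_x_le (Real.sqrt_pos.2 hc))
    rw [hx, smul_zero]
  · rw [mul_inv_cancel₀ h0, RCLike.ofReal_one, one_smul]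

end IsCoerciveWith

namespace IsFormProjector

theorem unique (hT : IsCoerciveWith c T) (hc : 0 < c) (h : IsFormProjector T V Q)
    (h' : IsFormProjector T V Q') : Q = Q' := by
  ext1 f
  have hmem : Q f - Q' f ∈ V := V.sub_mem (h f).1 (h' f).1
  refine sub_eq_zero.1 (hT.eq_zero_of_inner_eq_zero hc ?_)
  calc ⟪Q f - Q' f, T (Q f - Q' f)⟫_𝕜
      = ⟪Q f - Q' f, T (f - Q' f)⟫_𝕜 - ⟪Q f - Q' f, T (f - Q f)⟫_𝕜 := by
        rw [← inner_sub_right, ← map_sub, sub_sub_sub_cancel_left]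
    _ = 0 := by rw [(h' f).2 _ hmem, (h f).2 _ hmem, sub_zero]

/-- Lax–Milgram applied to the compression of `T` to `V`. -/
theorem exists_of_isCoerciveWith (hT : IsCoerciveWith c T) (hc : 0 < c) (V : Submodule 𝕜 E)
    [CompleteSpace V] : ∃ Q, IsFormProjector T V Q := by
  let P : E →L[𝕜] V := V.orthogonalProjectionOnto
  let A : V →L[𝕜] V := P ∘L T ∘L V.subtypeL
  have hA : IsUnit A := by
    refine A.isUnit_of_forall_le_norm_inner_map (c := ⟨c, hc.le⟩) hc fun x => ?_
    calc ‖x‖ ^ 2 * c = c * ‖(x : E)‖ ^ 2 := by rw [mul_comm, Submodule.coe_norm]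
      _ ≤ ‖⟪(x : E), T x⟫_𝕜‖ := (hT x).trans (RCLike.re_le_norm _)
      _ = ‖⟪A x, x⟫_𝕜‖ := by rw [norm_inner_symm]; simp [A, P]
  obtain ⟨S, hS⟩ := hA.exists_right_inv
  refine ⟨V.subtypeL ∘L S ∘L P ∘L T, fun f => ⟨(S (P (T f))).2, fun g hg => ?_⟩⟩
  have hP : P (T (f - S (P (T f)))) = 0 := by
    rw [map_sub, map_sub, sub_eq_zero]
    exact (DFunLike.congr_fun hS (P (T f))).symm
  exact V.orthogonalProjectionOnto_eq_zero_iff.1 hP g hg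

theorem existsUnique_of_isCoerciveWith (hT : IsCoerciveWith c T) (hc : 0 < c) (V : Submodule 𝕜 E)
    [CompleteSpace V] : ∃! Q, IsFormProjector T V Q :=
  let ⟨Q, hQ⟩ := exists_of_isCoerciveWith hT hc V
  ⟨Q, hQ, fun _ hQ' => hQ'.unique hT hc hQ⟩

theorem mul_norm_sub_apply_le (h : IsFormProjector T V Q) (hT : IsCoerciveWith c T) (f : E) :
    c * ‖f - Q f‖ ≤ ‖T‖ * ‖f‖ := by
  refine hT.mul_norm_le_of_re_inner_le (by positivity) ?_
  have hr : ⟪f - Q f, T (f - Q f)⟫_𝕜 = ⟪f, T (f - Q f)⟫_𝕜 := by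
    rw [inner_sub_left, (h f).2 _ (h f).1, sub_zero]
  calc RCLike.re ⟪f - Q f, T (f - Q f)⟫_𝕜 ≤ ‖f‖ * ‖T (f - Q f)‖ := by
        rw [hr]
        exact (RCLike.re_le_norm _).trans (norm_inner_le_norm _ _)
    _ ≤ ‖f‖ * (‖T‖ * ‖f - Q f‖) := by
        gcongr
        exact T.le_opNorm _
    _ = ‖f - Q f‖ * (‖T‖ * ‖f‖) := by ring

theorem norm_sub_le (h : IsFormProjector T V Q) (h' : IsFormProjector T' V Q')
    (hT : IsCoerciveWith c T) (hT' : IsCoerciveWith c T') (hc : 0 < c) :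
    ‖Q' - Q‖ ≤ ‖T' - T‖ * ‖T‖ / c ^ 2 := by
  refine ContinuousLinearMap.opNorm_le_bound _ (by positivity) fun f => ?_
  have hmem : (f - Q' f) - (f - Q f) ∈ V := by
    rw [sub_sub_sub_cancel_left]
    exact V.sub_mem (h f).1 (h' f).1
  have residual_sub_le := hT'.mul_norm_sub_le_of_orthogonal ((h f).2 _ hmem) ((h' f).2 _ hmem)
  rw [sub_sub_sub_cancel_left, norm_sub_rev] at residual_sub_le
  rw [sub_apply, div_mul_eq_mul_div, le_div_iff₀ (by positivity)]
  calc ‖Q' f - Q f‖ * c ^ 2 = c * (c * ‖Q' f - Q f‖) := by ring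
    _ ≤ c * (‖T' - T‖ * ‖f - Q f‖) := by gcongr
    _ = ‖T' - T‖ * (c * ‖f - Q f‖) := by ring
    _ ≤ ‖T' - T‖ * (‖T‖ * ‖f‖) :=
        mul_le_mul_of_nonneg_left (h.mul_norm_sub_apply_le hT f) (norm_nonneg _)
    _ = ‖T' - T‖ * ‖T‖ * ‖f‖ := by ring

end IsFormProjector

section Normalization

variable {a b : E}

theorem inner_sub_inner_eq_inner_sub_apply (hTs : (T : E →ₗ[𝕜] E).IsSymmetric)
    (ha : ⟪b - a, T a⟫_𝕜 = 0) (hb : ⟪b - a, T' b⟫_𝕜 = 0) :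
    ⟪b, T' b⟫_𝕜 - ⟪a, T a⟫_𝕜 = ⟪a, (T' - T) b⟫_𝕜 := by
  have hb' : ⟪b, T' b⟫_𝕜 = ⟪a, T' b⟫_𝕜 := by
    rwa [inner_sub_left, sub_eq_zero] at hb
  have ha' : ⟪a, T b⟫_𝕜 = ⟪a, T a⟫_𝕜 := by
    have h : ⟪a, T (b - a)⟫_𝕜 = 0 := by
      rw [← ContinuousLinearMap.coe_coe, ← hTs, ← inner_conj_symm, ContinuousLinearMap.coe_coe, ha,
        map_zero]
    rwa [map_sub, inner_sub_right, sub_eq_zero] at h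
  rw [hb', sub_apply, inner_sub_right, ha']

theorem IsCoerciveWith.sqrt_mul_abs_sqrt_energy_sub_le (hT : IsCoerciveWith c T)
    (hT' : IsCoerciveWith c T') (hc : 0 ≤ c) (hTs : (T : E →ₗ[𝕜] E).IsSymmetric)
    (ha : ⟪b - a, T a⟫_𝕜 = 0) (hb : ⟪b - a, T' b⟫_𝕜 = 0) :
    √c * |√(RCLike.re ⟪b, T' b⟫_𝕜) - √(RCLike.re ⟪a, T a⟫_𝕜)| ≤ ‖T' - T‖ * ‖a‖ := by
  have ha0 : 0 ≤ RCLike.re ⟪a, T a⟫_𝕜 := (by positivity : 0 ≤ c * ‖a‖ ^ 2).trans (hT a)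
  have hb0 : 0 ≤ RCLike.re ⟪b, T' b⟫_𝕜 := (by positivity : 0 ≤ c * ‖b‖ ^ 2).trans (hT' b)
  have energy_sub_le :
      |RCLike.re ⟪b, T' b⟫_𝕜 - RCLike.re ⟪a, T a⟫_𝕜| ≤ ‖a‖ * (‖T' - T‖ * ‖b‖) := by
    rw [← map_sub, inner_sub_inner_eq_inner_sub_apply hTs ha hb]
    refine (RCLike.abs_re_le_norm _).trans ((norm_inner_le_norm _ _).trans ?_)
    gcongr
    exact (T' - T).le_opNorm b
  have norm_b_le := hT'.sqrt_mul_norm_le hc b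
  set s := √(RCLike.re ⟪a, T a⟫_𝕜)
  set t := √(RCLike.re ⟪b, T' b⟫_𝕜)
  have hs : 0 ≤ s := Real.sqrt_nonneg _
  have ht : 0 ≤ t := Real.sqrt_nonneg _
  have hsq : |t - s| * (t + s) = |RCLike.re ⟪b, T' b⟫_𝕜 - RCLike.re ⟪a, T a⟫_𝕜| := by
    rw [← Real.sq_sqrt ha0, ← Real.sq_sqrt hb0, sq_sub_sq, abs_mul,
      abs_of_nonneg (add_nonneg ht hs), mul_comm]
  rcases (add_nonneg ht hs).eq_or_lt with hts | hts
  · rw [show t - s = 0 by linarith, abs_zero, mul_zero]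
    positivity
  · refine le_of_mul_le_mul_right ?_ hts
    calc √c * |t - s| * (t + s) ≤ √c * (‖a‖ * (‖T' - T‖ * ‖b‖)) := by
          rw [mul_assoc, hsq]
          gcongr
      _ = ‖T' - T‖ * ‖a‖ * (√c * ‖b‖) := by ring
      _ ≤ ‖T' - T‖ * ‖a‖ * (t + s) := by
          gcongr
          linarith

/-- With `s`, `t` the square roots of the energies of `a`, `b`, and `a₁`, `b₁` the normalized
vectors, `s (b₁ - a₁) = (b - a) - (t - s) b₁`, where both terms on the right are of size
`‖T' - T‖ ‖a‖`. -/
theorem IsCoerciveWith.mul_sqrt_energy_mul_norm_energyNormalize_sub_le (hT : IsCoerciveWith c T)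
    (hT' : IsCoerciveWith c T') (hc : 0 < c) (hTs : (T : E →ₗ[𝕜] E).IsSymmetric)
    (ha : ⟪b - a, T a⟫_𝕜 = 0) (hb : ⟪b - a, T' b⟫_𝕜 = 0) :
    c * (√(RCLike.re ⟪a, T a⟫_𝕜) * ‖energyNormalize T' b - energyNormalize T a‖) ≤
      2 * (‖T' - T‖ * ‖a‖) := by
  have sub_le := hT'.mul_norm_sub_le_of_orthogonal ha hb
  have sqrt_sub_le := hT.sqrt_mul_abs_sqrt_energy_sub_le hT' hc.le hTs ha hb
  have norm_normalize_le := hT'.sqrt_mul_norm_energyNormalize_le hc.le b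
  have smul_a := hT.sqrt_energy_smul_energyNormalize hc a
  have smul_b := hT'.sqrt_energy_smul_energyNormalize hc b
  set s := √(RCLike.re ⟪a, T a⟫_𝕜)
  set t := √(RCLike.re ⟪b, T' b⟫_𝕜)
  set a₁ := energyNormalize T a
  set b₁ := energyNormalize T' b
  have smul_sub : (s : 𝕜) • (b₁ - a₁) = (b - a) - ((t - s : ℝ) : 𝕜) • b₁ := by
    rw [← smul_a, ← smul_b]
    push_cast
    module
  calc c * (s * ‖b₁ - a₁‖) = c * ‖(b - a) - ((t - s : ℝ) : 𝕜) • b₁‖ := by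
        rw [← smul_sub, norm_smul, RCLike.norm_ofReal, abs_of_nonneg (Real.sqrt_nonneg _)]
    _ ≤ c * (‖b - a‖ + |t - s| * ‖b₁‖) := by
        gcongr
        refine (norm_sub_le _ _).trans_eq ?_
        rw [norm_smul, RCLike.norm_ofReal]
    _ = c * ‖b - a‖ + √c * |t - s| * (√c * ‖b₁‖) := by
        linear_combination -(|t - s| * ‖b₁‖) * Real.mul_self_sqrt hc.le
    _ ≤ ‖T' - T‖ * ‖a‖ + ‖T' - T‖ * ‖a‖ * 1 := by gcongr
    _ = 2 * (‖T' - T‖ * ‖a‖) := by ring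

theorem IsCoerciveWith.norm_energyNormalize_sub_le (hT : IsCoerciveWith c T)
    (hT' : IsCoerciveWith c T') (hc : 0 < c) (hTs : (T : E →ₗ[𝕜] E).IsSymmetric)
    (ha : ⟪b - a, T a⟫_𝕜 = 0) (hb : ⟪b - a, T' b⟫_𝕜 = 0) :
    ‖energyNormalize T' b - energyNormalize T a‖ ≤ 2 * ‖T' - T‖ / (c * √c) := by
  have scaled := hT.mul_sqrt_energy_mul_norm_energyNormalize_sub_le hT' hc hTs ha hb
  have norm_a_le := hT.sqrt_mul_norm_le hc.le a
  rcases eq_or_ne a 0 with rfl | ha0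
  · have sub_le := hT'.mul_norm_sub_le_of_orthogonal ha hb
    rw [sub_zero, norm_zero, mul_zero] at sub_le
    have hb0 : b = 0 := norm_le_zero_iff.1 (nonpos_of_mul_nonpos_right sub_le hc)
    simp only [hb0, energyNormalize, smul_zero, sub_zero, norm_zero]
    positivity
  · set s := √(RCLike.re ⟪a, T a⟫_𝕜)
    set d := ‖energyNormalize T' b - energyNormalize T a‖
    have hs : 0 < s :=
      (mul_pos (Real.sqrt_pos.2 hc) (norm_pos_iff.2 ha0)).trans_le norm_a_le
    rw [le_div_iff₀ (by positivity)]
    refine le_of_mul_le_mul_right ?_ hs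
    calc d * (c * √c) * s = √c * (c * (s * d)) := by ring
      _ ≤ √c * (2 * (‖T' - T‖ * ‖a‖)) := by gcongr
      _ = 2 * ‖T' - T‖ * (√c * ‖a‖) := by ring
      _ ≤ 2 * ‖T' - T‖ * s := by gcongr

end Normalization

end Coercive

section GramSchmidt

variable {B B' : L2 → L2 → ℂ} {T T' : L2 →L[ℂ] L2} {dom V : Submodule ℂ L2}

/-- The form `B`, linear in its first variable, is given on `dom × V` by the bounded operator `T`.
The two subspaces differ because an unbounded form on `dom` can still be bounded against each fixed
`g ∈ V`. -/
def IsRepresentedBy (B : L2 → L2 → ℂ) (T : L2 →L[ℂ] L2) (dom V : Submodule ℂ L2) : Prop :=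
  ∀ f ∈ dom, ∀ g ∈ V, B f g = ⟪g, T f⟫_ℂ

theorem IsRepresentedBy.mono {dom' V' : Submodule ℂ L2} (hB : IsRepresentedBy B T dom V)
    (hdom : dom' ≤ dom) (hV : V' ≤ V) : IsRepresentedBy B T dom' V' :=
  fun f hf g hg => hB f (hdom hf) g (hV hg)

theorem IsRepresentedBy.isOrthProjector_iff (hB : IsRepresentedBy B T dom V)
    (hdom : Dense (dom : Set L2)) (hV : IsClosed (V : Set L2)) (hle : V ≤ dom)
    {Q : L2 →L[ℂ] L2} : IsOrthProjector B dom V Q ↔ IsFormProjector T V Q := by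
  have form_eq : ∀ f ∈ dom, Q f ∈ V → ∀ g ∈ V, B (f - Q f) g = ⟪g, T (f - Q f)⟫_ℂ :=
    fun f hf hQ g hg => hB _ (dom.sub_mem hf (hle hQ)) g hg
  constructor
  · intro h f
    have hmem : ∀ f, Q f ∈ V := fun f =>
      (hV.preimage Q.continuous).closure_subset_iff.2 (fun f hf => (h f hf).1) (hdom f)
    refine ⟨hmem f, fun g hg => ?_⟩
    have hclosed : IsClosed {f | ⟪g, T (f - Q f)⟫_ℂ = 0} :=
      isClosed_eq (by fun_prop) continuous_const
    exact hclosed.closure_subset_iff.2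
      (fun f hf => (form_eq f hf (hmem f) g hg).symm.trans ((h f hf).2 g hg)) (hdom f)
  · exact fun h f hf =>
      ⟨(h f).1, fun g hg => (form_eq f hf (h f).1 g hg).trans ((h f).2 g hg)⟩

variable {m : ℕ} {v : Fin m → L2} {c : ℝ}

theorem sub_gramSchmidtAux_mem_span_gramSchmidtAux (B : L2 → L2 → ℂ) (v : Fin m → L2)
    (k : Fin m) :
    v k - gramSchmidtAux B v k ∈ Submodule.span ℂ (gramSchmidtAux B v '' Iio k) := by
  rw [gramSchmidtAux, sub_sub_cancel]
  exact Submodule.sum_mem _ fun j _ => Submodule.smul_mem _ _ <|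
    Submodule.subset_span ⟨j, Finset.mem_Iio.1 j.2, rfl⟩

theorem span_gramSchmidtAux_Iio (B : L2 → L2 → ℂ) (v : Fin m → L2) (k : Fin m) :
    Submodule.span ℂ (gramSchmidtAux B v '' Iio k) = Submodule.span ℂ (v '' Iio k) := by
  induction k using WellFoundedLT.induction with
  | ind k ih =>
    refine le_antisymm (Submodule.span_le.2 ?_) (Submodule.span_le.2 ?_)
    all_goals
      rintro _ ⟨j, hj, rfl⟩
      have hsub := Submodule.span_mono (image_mono (Iio_subset_Iio (le_of_lt hj)))
        (sub_gramSchmidtAux_mem_span_gramSchmidtAux B v j)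
    · have hsub' := Submodule.span_mono (image_mono (Iio_subset_Iio (le_of_lt hj)))
        (ih j hj ▸ sub_gramSchmidtAux_mem_span_gramSchmidtAux B v j)
      rw [← sub_sub_cancel (v j) (gramSchmidtAux B v j)]
      exact Submodule.sub_mem _ (Submodule.subset_span ⟨j, hj, rfl⟩) hsub'
    · rw [← sub_add_cancel (v j) (gramSchmidtAux B v j)]
      exact Submodule.add_mem _ hsub (Submodule.subset_span ⟨j, hj, rfl⟩)

theorem sub_gramSchmidtAux_mem_span (B : L2 → L2 → ℂ) (v : Fin m → L2) (k : Fin m) :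
    v k - gramSchmidtAux B v k ∈ Submodule.span ℂ (v '' Iio k) :=
  span_gramSchmidtAux_Iio B v k ▸ sub_gramSchmidtAux_mem_span_gramSchmidtAux B v k

theorem gramSchmidtAux_mem_span_range (B : L2 → L2 → ℂ) (v : Fin m → L2) (k : Fin m) :
    gramSchmidtAux B v k ∈ Submodule.span ℂ (range v) := by
  rw [← sub_sub_cancel (v k) (gramSchmidtAux B v k)]
  exact Submodule.sub_mem _ (Submodule.subset_span ⟨k, rfl⟩)
    (Submodule.span_mono (image_subset_range v _) (sub_gramSchmidtAux_mem_span B v k))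

namespace IsRepresentedBy

theorem inner_gramSchmidtAux_eq_zero
    (hB : IsRepresentedBy B T (Submodule.span ℂ (range v)) (Submodule.span ℂ (range v)))
    (hT : IsCoerciveWith c T) (hc : 0 < c) (hTs : (T : L2 →ₗ[ℂ] L2).IsSymmetric) {i k : Fin m}
    (hik : i < k) : ⟪gramSchmidtAux B v i, T (gramSchmidtAux B v k)⟫_ℂ = 0 := by
  induction k using WellFoundedLT.induction generalizing i with
  | ind k ih =>
    have hg := gramSchmidtAux_mem_span_range B v
    have earlier : ∀ j < k, j ≠ i →
        ⟪gramSchmidtAux B v i, T (gramSchmidtAux B v j)⟫_ℂ = 0 := by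
      intro j hj hji
      rcases lt_or_gt_of_ne hji with h | h
      · rw [← ContinuousLinearMap.coe_coe, ← hTs, ← inner_conj_symm, ContinuousLinearMap.coe_coe,
          ih i hik h, map_zero]
      · exact ih j hj h
    rw [gramSchmidtAux.eq_1 B v k]
    simp only [map_sub, map_sum, map_smul, inner_sub_right, inner_sum, inner_smul_right]
    rw [Finset.sum_eq_single_of_mem ⟨i, Finset.mem_Iio.2 hik⟩ (Finset.mem_univ _) fun j _ hj => by
      rw [earlier j (Finset.mem_Iio.1 j.2) fun h => hj (Subtype.ext h), mul_zero]]
    rw [hB _ (Submodule.subset_span ⟨k, rfl⟩) _ (hg i), hB _ (hg i) _ (hg i)]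
    by_cases h0 : ⟪gramSchmidtAux B v i, T (gramSchmidtAux B v i)⟫_ℂ = 0
    · simp only [hT.eq_zero_of_inner_eq_zero hc h0, inner_zero_left, zero_div, zero_mul, sub_zero]
    · rw [div_mul_cancel₀ _ h0, sub_self]

theorem inner_gramSchmidtAux_eq_zero_of_mem_span
    (hB : IsRepresentedBy B T (Submodule.span ℂ (range v)) (Submodule.span ℂ (range v)))
    (hT : IsCoerciveWith c T) (hc : 0 < c) (hTs : (T : L2 →ₗ[ℂ] L2).IsSymmetric) {k : Fin m}
    {x : L2} (hx : x ∈ Submodule.span ℂ (v '' Iio k)) :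
    ⟪x, T (gramSchmidtAux B v k)⟫_ℂ = 0 := by
  have hle : Submodule.span ℂ (gramSchmidtAux B v '' Iio k) ≤
      (ℂ ∙ T (gramSchmidtAux B v k))ᗮ := by
    rw [Submodule.span_le]
    rintro _ ⟨i, hi, rfl⟩
    exact Submodule.mem_orthogonal_singleton_iff_inner_left.2
      (hB.inner_gramSchmidtAux_eq_zero hT hc hTs hi)
  rw [span_gramSchmidtAux_Iio] at hle
  exact Submodule.mem_orthogonal_singleton_iff_inner_left.1 (hle hx)

theorem gramSchmidtBasis_eq_energyNormalize
    (hB : IsRepresentedBy B T (Submodule.span ℂ (range v)) (Submodule.span ℂ (range v)))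
    (k : Fin m) : gramSchmidtBasis B v k = energyNormalize T (gramSchmidtAux B v k) := by
  have hg := gramSchmidtAux_mem_span_range B v k
  rw [gramSchmidtBasis, hB _ hg _ hg]
  rfl

theorem norm_gramSchmidtBasis_sub_le
    (hB : IsRepresentedBy B T (Submodule.span ℂ (range v)) (Submodule.span ℂ (range v)))
    (hB' : IsRepresentedBy B' T' (Submodule.span ℂ (range v)) (Submodule.span ℂ (range v)))
    (hT : IsCoerciveWith c T) (hT' : IsCoerciveWith c T') (hc : 0 < c)
    (hTs : (T : L2 →ₗ[ℂ] L2).IsSymmetric) (hTs' : (T' : L2 →ₗ[ℂ] L2).IsSymmetric) (k : Fin m) :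
    ‖gramSchmidtBasis B' v k - gramSchmidtBasis B v k‖ ≤ 2 * ‖T' - T‖ / (c * √c) := by
  have hmem : gramSchmidtAux B' v k - gramSchmidtAux B v k ∈ Submodule.span ℂ (v '' Iio k) := by
    rw [← sub_sub_sub_cancel_left _ _ (v k)]
    exact Submodule.sub_mem _ (sub_gramSchmidtAux_mem_span B v k)
      (sub_gramSchmidtAux_mem_span B' v k)
  rw [hB.gramSchmidtBasis_eq_energyNormalize, hB'.gramSchmidtBasis_eq_energyNormalize]
  exact hT.norm_energyNormalize_sub_le hT' hc hTs
    (hB.inner_gramSchmidtAux_eq_zero_of_mem_span hT hc hTs hmem)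
    (hB'.inner_gramSchmidtAux_eq_zero_of_mem_span hT' hc hTs' hmem)

end IsRepresentedBy

end GramSchmidt

section Multiplication

variable {α 𝕜 : Type*} [MeasurableSpace α] {μ : Measure α} [RCLike 𝕜] {w : α → ℝ}

/-- Multiplication by the real bounded weight `w`, as an operator on `L²(μ; 𝕜)`. -/
noncomputable def mulOp (𝕜 : Type*) [RCLike 𝕜] (w : α → ℝ) (hw : MemLp w ∞ μ) :
    Lp 𝕜 2 μ →L[𝕜] Lp 𝕜 2 μ :=
  (ContinuousLinearMap.mul 𝕜 𝕜).holderL μ ∞ 2 2 (hw.ofReal (K := 𝕜)).toLp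

theorem coeFn_mulOp (hw : MemLp w ∞ μ) (f : Lp 𝕜 2 μ) :
    mulOp 𝕜 w hw f =ᵐ[μ] fun x => (w x : 𝕜) * f x := by
  refine (ContinuousLinearMap.coeFn_holder (r := 2) (ContinuousLinearMap.mul 𝕜 𝕜)
    (hw.ofReal (K := 𝕜)).toLp f).trans ?_
  filter_upwards [(hw.ofReal (K := 𝕜)).coeFn_toLp] with x hx
  rw [ContinuousLinearMap.mul_apply', hx]

theorem isSymmetric_mulOp (hw : MemLp w ∞ μ) :
    (mulOp 𝕜 w hw : Lp 𝕜 2 μ →ₗ[𝕜] Lp 𝕜 2 μ).IsSymmetric := by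
  intro f g
  simp only [ContinuousLinearMap.coe_coe, L2.inner_def]
  refine integral_congr_ae ?_
  filter_upwards [coeFn_mulOp hw f, coeFn_mulOp hw g] with x hf hg
  rw [hf, hg, RCLike.inner_apply, RCLike.inner_apply, map_mul, RCLike.conj_ofReal]
  ring

theorem isCoerciveWith_mulOp (hw : MemLp w ∞ μ) {c : ℝ} (hc : ∀ᵐ x ∂μ, c ≤ w x) :
    IsCoerciveWith c (mulOp 𝕜 w hw) := by
  intro f
  have integrable_re (g : Lp 𝕜 2 μ) : Integrable (fun x => RCLike.re ⟪f x, g x⟫_𝕜) μ :=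
    (L2.integrable_inner f g).re
  have re_inner_eq (g : Lp 𝕜 2 μ) :
      RCLike.re ⟪f, g⟫_𝕜 = ∫ x, RCLike.re ⟪f x, g x⟫_𝕜 ∂μ := by
    rw [L2.inner_def]
    exact (integral_re (L2.integrable_inner f g)).symm
  rw [norm_sq_eq_re_inner (𝕜 := 𝕜) f, re_inner_eq, re_inner_eq, ← integral_const_mul]
  refine integral_mono_ae ((integrable_re f).const_mul c) (integrable_re _) ?_
  filter_upwards [coeFn_mulOp hw f, hc] with x hx hcx
  rw [hx, ← smul_eq_mul (w x : 𝕜), inner_smul_right, RCLike.re_ofReal_mul]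
  exact mul_le_mul_of_nonneg_right hcx inner_self_nonneg

theorem norm_mulOp_le (hw : MemLp w ∞ μ) {M : ℝ} (hM : 0 ≤ M) (hwM : ∀ᵐ x ∂μ, |w x| ≤ M) :
    ‖mulOp 𝕜 w hw‖ ≤ M := by
  have norm_weight_le : ‖(hw.ofReal (K := 𝕜)).toLp‖ ≤ M := by
    rw [Lp.norm_toLp, eLpNorm_exponent_top]
    refine ENNReal.toReal_le_of_le_ofReal hM (eLpNormEssSup_le_of_ae_bound ?_)
    filter_upwards [hwM] with x hx
    rwa [RCLike.norm_ofReal]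
  refine ContinuousLinearMap.opNorm_le_bound _ hM fun f => ?_
  calc ‖mulOp 𝕜 w hw f‖
      ≤ ‖ContinuousLinearMap.mul 𝕜 𝕜‖ * ‖(hw.ofReal (K := 𝕜)).toLp‖ * ‖f‖ :=
        ContinuousLinearMap.norm_holder_apply_apply_le _ _ _
    _ ≤ 1 * M * ‖f‖ := by
        gcongr
        exact ContinuousLinearMap.opNorm_mul_le 𝕜 𝕜
    _ = M * ‖f‖ := by rw [one_mul]

theorem isRepresentedBy_weightedForm {w : S1 → ℝ} (hw : MemLp w ∞ μ₀) :
    IsRepresentedBy (weightedForm w) (mulOp ℂ w hw) ⊤ ⊤ := by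
  intro f _ g _
  rw [weightedForm, L2.inner_def]
  refine integral_congr_ae ?_
  filter_upwards [coeFn_mulOp hw f] with θ hθ
  rw [hθ, RCLike.inner_apply]
  exact (mul_comm _ _).trans (mul_assoc _ _ _).symm

end Multiplication

theorem norm_sum_smul_rankOne_le {𝕜 E ι : Type*} [RCLike 𝕜] [NormedAddCommGroup E]
    [InnerProductSpace 𝕜 E] {v : ι → E} (hv : Orthonormal 𝕜 v) (s : Finset ι) {a : ι → 𝕜} {M : ℝ}
    (hM : 0 ≤ M) (ha : ∀ i ∈ s, ‖a i‖ ≤ M) :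
    ‖∑ i ∈ s, a i • InnerProductSpace.rankOne 𝕜 (v i) (v i)‖ ≤ M := by
  refine ContinuousLinearMap.opNorm_le_bound _ hM fun f => ?_
  refine le_of_sq_le_sq ?_ (by positivity)
  have norm_sq_sum : ‖∑ i ∈ s, (a i * ⟪v i, f⟫_𝕜) • v i‖ ^ 2 =
      ∑ i ∈ s, ‖a i * ⟪v i, f⟫_𝕜‖ ^ 2 := by
    have h := hv.inner_sum (fun i => a i * ⟪v i, f⟫_𝕜) (fun i => a i * ⟪v i, f⟫_𝕜) s
    simp only [inner_self_eq_norm_sq_to_K, RCLike.conj_mul] at h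
    exact_mod_cast h
  have apply_eq : (∑ i ∈ s, a i • InnerProductSpace.rankOne 𝕜 (v i) (v i)) f =
      ∑ i ∈ s, (a i * ⟪v i, f⟫_𝕜) • v i := by
    simp [sum_apply, mul_smul]
  calc ‖(∑ i ∈ s, a i • InnerProductSpace.rankOne 𝕜 (v i) (v i)) f‖ ^ 2
      = ∑ i ∈ s, ‖a i‖ ^ 2 * ‖⟪v i, f⟫_𝕜‖ ^ 2 := by
        simp only [apply_eq, norm_sq_sum, norm_mul, mul_pow]
    _ ≤ ∑ i ∈ s, M ^ 2 * ‖⟪v i, f⟫_𝕜‖ ^ 2 := by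
        gcongr with i hi
        exact ha i hi
    _ ≤ M ^ 2 * ‖f‖ ^ 2 := by
        rw [← Finset.mul_sum]
        gcongr
        exact hv.sum_inner_products_le f
    _ = (M * ‖f‖) ^ 2 := (mul_pow _ _ _).symm

section Fourier

theorem fourierCoeff_eq_inner (f : L2) (n : ℤ) :
    fourierCoeff (f : S1 → ℂ) n = ⟪e n, f⟫_ℂ := by
  rw [← fourierBasis_repr, HilbertBasis.repr_apply_apply, coe_fourierBasis]

theorem inner_e_e (m n : ℤ) : ⟪e m, e n⟫_ℂ = if m = n then 1 else 0 :=
  orthonormal_iff_ite.1 orthonormal_fourier m n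

/-- The operator `-∂_θ²` compressed to `trigPoly N`: it is bounded on `L²`, and agrees with `-∂_θ²`
when tested against trigonometric polynomials of degree at most `N`. -/
noncomputable def freqOp (N : ℕ) : L2 →L[ℂ] L2 :=
  ∑ n ∈ Finset.Icc (-(N : ℤ)) N, ((n : ℂ) ^ 2) • InnerProductSpace.rankOne ℂ (e n) (e n)

theorem inner_freqOp (N : ℕ) (f g : L2) : ⟪g, freqOp N f⟫_ℂ =
    ∑ n ∈ Finset.Icc (-(N : ℤ)) N, (n : ℂ) ^ 2 * (⟪g, e n⟫_ℂ * ⟪e n, f⟫_ℂ) := by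
  simp only [freqOp, sum_apply, smul_apply, InnerProductSpace.rankOne_apply, inner_sum,
    inner_smul_right, mul_comm ⟪g, e _⟫_ℂ]

open ComplexOrder in
theorem isPositive_freqOp (N : ℕ) : (freqOp N).IsPositive := by
  refine ContinuousLinearMap.isPositive_sum _ fun n _ => ?_
  refine (InnerProductSpace.isPositive_rankOne_self (e n)).smul_of_nonneg ?_
  exact_mod_cast sq_nonneg n

theorem norm_freqOp_le (N : ℕ) : ‖freqOp N‖ ≤ (N : ℝ) ^ 2 := by
  refine norm_sum_smul_rankOne_le orthonormal_fourier _ (by positivity) fun n hn => ?_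
  rw [norm_pow, Complex.norm_intCast]
  gcongr
  exact_mod_cast abs_le.2 (Finset.mem_Icc.1 hn)

instance finiteDimensional_trigPoly (N : ℕ) : FiniteDimensional ℂ (trigPoly N) := by
  refine FiniteDimensional.span_of_finite ℂ (Set.Finite.image _ ?_)
  exact (Set.finite_Icc (-(N : ℤ)) N).subset fun n hn => abs_le.1 hn

theorem span_range_modes_le_trigPoly (N : ℕ) :
    Submodule.span ℂ (range (modes N)) ≤ trigPoly N := by
  refine Submodule.span_mono ?_
  rintro _ ⟨k, rfl⟩
  have hk := k.2
  exact ⟨_, (abs_le.2 ⟨by omega, by omega⟩ : |(k : ℤ) - N| ≤ N), rfl⟩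

theorem mem_H1_iff {f : L2} :
    f ∈ H1 ↔ Summable fun n : ℤ => (1 + (n : ℝ) ^ 2) * ‖⟪e n, f⟫_ℂ‖ ^ 2 := by
  simp only [H1, mem_ofPred_eq, fourierCoeff_eq_inner]

/-- The Sobolev space `H1` as a subspace of `L2`. -/
noncomputable def H1Submodule : Submodule ℂ L2 where
  carrier := H1
  zero_mem' := by
    rw [mem_H1_iff]
    simpa only [inner_zero_right, norm_zero, ne_eq, OfNat.ofNat_ne_zero, not_false_eq_true,
      zero_pow, mul_zero] using summable_zero
  add_mem' {f g} hf hg := by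
    rw [mem_H1_iff] at hf hg ⊢
    refine .of_nonneg_of_le (fun n => by positivity) (fun n => ?_) ((hf.add hg).mul_left 2)
    calc (1 + (n : ℝ) ^ 2) * ‖⟪e n, f + g⟫_ℂ‖ ^ 2
        ≤ (1 + (n : ℝ) ^ 2) * (2 * (‖⟪e n, f⟫_ℂ‖ ^ 2 + ‖⟪e n, g⟫_ℂ‖ ^ 2)) := by
          rw [inner_add_right]
          gcongr
          exact (pow_le_pow_left₀ (norm_nonneg _) (norm_add_le _ _) 2).trans add_sq_le
      _ = 2 * ((1 + (n : ℝ) ^ 2) * ‖⟪e n, f⟫_ℂ‖ ^ 2 +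
            (1 + (n : ℝ) ^ 2) * ‖⟪e n, g⟫_ℂ‖ ^ 2) := by ring
  smul_mem' a f hf := by
    rw [mem_H1_iff] at hf ⊢
    refine (hf.mul_left (‖a‖ ^ 2)).congr fun n => ?_
    rw [inner_smul_right, norm_mul]
    ring

theorem e_mem_H1Submodule (n : ℤ) : e n ∈ H1Submodule := by
  refine mem_H1_iff.2 (summable_of_ne_finset_zero (s := {n}) fun m hm => ?_)
  rw [inner_e_e, if_neg (by simpa using hm), norm_zero, zero_pow two_ne_zero, mul_zero]

theorem trigPoly_le_H1Submodule (N : ℕ) : trigPoly N ≤ H1Submodule := by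
  rw [trigPoly, Submodule.span_le]
  rintro _ ⟨n, -, rfl⟩
  exact e_mem_H1Submodule n

theorem dense_H1Submodule : Dense (H1Submodule : Set L2) := by
  have span_le : Submodule.span ℂ (range e) ≤ H1Submodule := by
    rw [Submodule.span_le]
    rintro _ ⟨n, rfl⟩
    exact e_mem_H1Submodule n
  exact (Submodule.dense_iff_topologicalClosure_eq_top.2
    (span_fourierLp_closure_eq_top (p := 2) ENNReal.ofNat_ne_top)).mono span_le

theorem hasSum_D {f : L2} (hf : f ∈ H1) :
    HasSum (fun n : ℤ => (Complex.I * n * fourierCoeff (f : S1 → ℂ) n) • e n) (D f) := by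
  refine Summable.hasSum ?_
  refine (orthonormal_fourier.orthogonalFamily.summable_iff_norm_sq_summable
    fun n : ℤ => Complex.I * (n : ℂ) * fourierCoeff (f : S1 → ℂ) n).2 ?_
  refine .of_nonneg_of_le (fun n => by positivity) (fun n => ?_) hf
  rw [norm_mul, norm_mul, Complex.norm_I, one_mul, mul_pow, Complex.norm_intCast, sq_abs]
  gcongr
  exact le_add_of_nonneg_left zero_le_one

theorem inner_e_D {f : L2} (hf : f ∈ H1) (n : ℤ) :
    ⟪e n, D f⟫_ℂ = Complex.I * n * ⟪e n, f⟫_ℂ := by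
  have h := (hasSum_D hf).mapL (innerSL ℂ (e n))
  simp only [innerSL_apply_apply, inner_smul_right, inner_e_e, fourierCoeff_eq_inner] at h
  refine h.unique ?_
  convert hasSum_single n fun m hm => ?_ using 1
  · simp only [if_pos, mul_one]
  · rw [if_neg hm.symm, mul_zero]

theorem inner_e_eq_zero_of_mem_trigPoly {N : ℕ} {g : L2} (hg : g ∈ trigPoly N) {n : ℤ}
    (hn : n ∉ Finset.Icc (-(N : ℤ)) N) : ⟪e n, g⟫_ℂ = 0 := by
  have hle : trigPoly N ≤ (ℂ ∙ e n)ᗮ := by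
    rw [trigPoly, Submodule.span_le]
    rintro _ ⟨m, hm, rfl⟩
    refine Submodule.mem_orthogonal_singleton_iff_inner_right.2 ?_
    rw [inner_e_e, if_neg]
    rintro rfl
    exact hn (Finset.mem_Icc.2 (abs_le.1 hm))
  exact Submodule.mem_orthogonal_singleton_iff_inner_right.1 (hle hg)

theorem inner_D_D {N : ℕ} {f g : L2} (hf : f ∈ H1) (hg : g ∈ trigPoly N) :
    ⟪D g, D f⟫_ℂ = ⟪g, freqOp N f⟫_ℂ := by
  have parseval := (fourierBasis (T := 2 * Real.pi)).hasSum_inner_mul_inner (D g) (D f)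
  have hgH : g ∈ H1 := trigPoly_le_H1Submodule N hg
  have term_eq (n : ℤ) : ⟪D g, e n⟫_ℂ * ⟪e n, D f⟫_ℂ =
      (n : ℂ) ^ 2 * (⟪g, e n⟫_ℂ * ⟪e n, f⟫_ℂ) := by
    rw [← inner_conj_symm (D g), inner_e_D hf, inner_e_D hgH, ← inner_conj_symm g]
    simp only [map_mul, Complex.conj_I, map_intCast]
    linear_combination -((n : ℂ) ^ 2 * (conj ⟪e n, g⟫_ℂ * ⟪e n, f⟫_ℂ)) * Complex.I_sq
  simp only [coe_fourierBasis, term_eq] at parseval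
  rw [inner_freqOp]
  refine parseval.unique (hasSum_sum_of_ne_finset_zero fun n hn => ?_)
  rw [inner_eq_zero_symm.1 (inner_e_eq_zero_of_mem_trigPoly hg hn), zero_mul, mul_zero]

end Fourier

section SobolevForm

variable {w : S1 → ℝ} {lam wm : ℝ} {N : ℕ}

/-- The bounded operator `w - lam ∂_θ²`, with `-∂_θ²` compressed to `trigPoly N`. -/
noncomputable def sobolevOp (w : S1 → ℝ) (hw : MemLp w ∞ μ₀) (lam : ℝ) (N : ℕ) : L2 →L[ℂ] L2 :=
  mulOp ℂ w hw + (lam : ℂ) • freqOp N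

theorem isRepresentedBy_sobolevForm (hw : MemLp w ∞ μ₀) (lam : ℝ) (N : ℕ) :
    IsRepresentedBy (sobolevForm w lam) (sobolevOp w hw lam N) H1Submodule (trigPoly N) := by
  intro f hf g hg
  rw [sobolevForm, isRepresentedBy_weightedForm hw f trivial g trivial, sobolevOp, add_apply,
    smul_apply, inner_add_right, inner_smul_right, ← inner_D_D hf hg, L2.inner_def (D g)]
  rfl

open ComplexOrder in
theorem isPositive_smul_freqOp (hlam : 0 ≤ lam) (N : ℕ) : ((lam : ℂ) • freqOp N).IsPositive :=
  (isPositive_freqOp N).smul_of_nonneg (by exact_mod_cast hlam)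

theorem isCoerciveWith_sobolevOp (hw : MemLp w ∞ μ₀) (hwm : ∀ᵐ θ ∂μ₀, wm ≤ w θ) (hlam : 0 ≤ lam)
    (N : ℕ) : IsCoerciveWith wm (sobolevOp w hw lam N) :=
  (isCoerciveWith_mulOp hw hwm).add_isPositive (isPositive_smul_freqOp hlam N)

theorem isSymmetric_sobolevOp (hw : MemLp w ∞ μ₀) (hlam : 0 ≤ lam) (N : ℕ) :
    (sobolevOp w hw lam N : L2 →ₗ[ℂ] L2).IsSymmetric :=
  (isSymmetric_mulOp hw).add (isPositive_smul_freqOp hlam N).isSymmetric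

theorem norm_sobolevOp_sub_mulOp_le (hw : MemLp w ∞ μ₀) (hlam : 0 ≤ lam) (N : ℕ) :
    ‖sobolevOp w hw lam N - mulOp ℂ w hw‖ ≤ lam * N ^ 2 := by
  rw [sobolevOp, add_sub_cancel_left, norm_smul, Complex.norm_of_nonneg hlam]
  gcongr
  exact norm_freqOp_le N

theorem isOrthProjector_weightedForm_iff (hw : MemLp w ∞ μ₀) {V : Submodule ℂ L2}
    {Q : L2 →L[ℂ] L2} :
    IsOrthProjector (weightedForm w) univ V Q ↔ IsFormProjector (mulOp ℂ w hw) V Q := by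
  have form_eq (f g : L2) : weightedForm w f g = ⟪g, mulOp ℂ w hw f⟫_ℂ :=
    isRepresentedBy_weightedForm hw f trivial g trivial
  simp only [IsOrthProjector, IsFormProjector, form_eq, mem_univ, true_imp_iff]

theorem isOrthProjector_sobolevForm_iff (hw : MemLp w ∞ μ₀) {Q : L2 →L[ℂ] L2} :
    IsOrthProjector (sobolevForm w lam) H1 (trigPoly N) Q ↔
      IsFormProjector (sobolevOp w hw lam N) (trigPoly N) Q :=
  (isRepresentedBy_sobolevForm hw lam N).isOrthProjector_iff dense_H1Submodule
    (trigPoly N).closed_of_finiteDimensional (trigPoly_le_H1Submodule N)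

theorem existsUnique_isOrthProjector_weightedForm (hw : MemLp w ∞ μ₀)
    (hwm : ∀ᵐ θ ∂μ₀, wm ≤ w θ) (hwm0 : 0 < wm) (V : Submodule ℂ L2) [CompleteSpace V] :
    ∃! Q, IsOrthProjector (weightedForm w) univ V Q := by
  simp only [isOrthProjector_weightedForm_iff hw]
  exact IsFormProjector.existsUnique_of_isCoerciveWith (isCoerciveWith_mulOp hw hwm) hwm0 V

theorem existsUnique_isOrthProjector_sobolevForm (hw : MemLp w ∞ μ₀)
    (hwm : ∀ᵐ θ ∂μ₀, wm ≤ w θ) (hwm0 : 0 < wm) (hlam : 0 ≤ lam) (N : ℕ) :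
    ∃! Q, IsOrthProjector (sobolevForm w lam) H1 (trigPoly N) Q := by
  simp only [isOrthProjector_sobolevForm_iff hw]
  exact IsFormProjector.existsUnique_of_isCoerciveWith
    (isCoerciveWith_sobolevOp hw hwm hlam N) hwm0 _

theorem norm_sub_le_of_isOrthProjector_sobolevForm (hw : MemLp w ∞ μ₀) {wp : ℝ} (hwm0 : 0 < wm)
    (hbd : ∀ᵐ θ ∂μ₀, wm ≤ w θ ∧ w θ ≤ wp) (hlam : 0 ≤ lam) {Q Q₀ : L2 →L[ℂ] L2}
    (hQ : IsOrthProjector (sobolevForm w lam) H1 (trigPoly N) Q)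
    (hQ₀ : IsOrthProjector (weightedForm w) univ (trigPoly N) Q₀) :
    ‖Q - Q₀‖ ≤ N ^ 2 * wp / wm ^ 2 * lam := by
  have hwm : ∀ᵐ θ ∂μ₀, wm ≤ w θ := hbd.mono fun _ h => h.1
  have hwp : 0 ≤ wp := by
    obtain ⟨θ, h⟩ := hbd.exists
    exact hwm0.le.trans (h.1.trans h.2)
  have norm_le : ‖mulOp ℂ w hw‖ ≤ wp := norm_mulOp_le hw hwp <| hbd.mono fun θ h => by
    rw [abs_of_pos (hwm0.trans_le h.1)]
    exact h.2
  rw [isOrthProjector_sobolevForm_iff hw] at hQ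
  rw [isOrthProjector_weightedForm_iff hw] at hQ₀
  calc ‖Q - Q₀‖ ≤ ‖sobolevOp w hw lam N - mulOp ℂ w hw‖ * ‖mulOp ℂ w hw‖ / wm ^ 2 :=
        hQ₀.norm_sub_le hQ (isCoerciveWith_mulOp hw hwm)
          (isCoerciveWith_sobolevOp hw hwm hlam N) hwm0
    _ ≤ lam * N ^ 2 * wp / wm ^ 2 := by
        gcongr
        exact norm_sobolevOp_sub_mulOp_le hw hlam N
    _ = N ^ 2 * wp / wm ^ 2 * lam := by ring

theorem norm_gramSchmidtBasis_sobolevForm_sub_weightedForm_le (hw : MemLp w ∞ μ₀)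
    (hwm : ∀ᵐ θ ∂μ₀, wm ≤ w θ) (hwm0 : 0 < wm) (hlam : 0 ≤ lam) (k : Fin (2 * N + 1)) :
    ‖gramSchmidtBasis (sobolevForm w lam) (modes N) k -
        gramSchmidtBasis (weightedForm w) (modes N) k‖ ≤ 2 * N ^ 2 / (wm * √wm) * lam := by
  have hspan := span_range_modes_le_trigPoly N
  calc ‖gramSchmidtBasis (sobolevForm w lam) (modes N) k -
        gramSchmidtBasis (weightedForm w) (modes N) k‖
      ≤ 2 * ‖sobolevOp w hw lam N - mulOp ℂ w hw‖ / (wm * √wm) :=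
        ((isRepresentedBy_weightedForm hw).mono le_top le_top).norm_gramSchmidtBasis_sub_le
          ((isRepresentedBy_sobolevForm hw lam N).mono
            (hspan.trans (trigPoly_le_H1Submodule N)) hspan)
          (isCoerciveWith_mulOp hw hwm) (isCoerciveWith_sobolevOp hw hwm hlam N) hwm0
          (isSymmetric_mulOp hw) (isSymmetric_sobolevOp hw hlam N) k
    _ ≤ 2 * (lam * N ^ 2) / (wm * √wm) := by
        gcongr
        exact norm_sobolevOp_sub_mulOp_le hw hlam N
    _ = 2 * N ^ 2 / (wm * √wm) * lam := by ring

end SobolevForm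

end S1Model

open S1Model in
theorem mainTheorem9_general (N : ℕ) (wm wp : ℝ) (hwm : 0 < wm) :
    ∃ C : ℝ, 0 < C ∧ ∀ w : S1 → ℝ, AEStronglyMeasurable w μ₀ →
      (∀ᵐ θ ∂μ₀, wm ≤ w θ ∧ w θ ≤ wp) →
        (∃! Q₀, IsOrthProjector (weightedForm w) univ (trigPoly N) Q₀) ∧
        (∀ lam : ℝ, 0 < lam → ∃! Q, IsOrthProjector (sobolevForm w lam) H1 (trigPoly N) Q) ∧
        (∀ lam : ℝ, 0 < lam → ∀ Q Q₀ : L2 →L[ℂ] L2,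
          IsOrthProjector (sobolevForm w lam) H1 (trigPoly N) Q →
          IsOrthProjector (weightedForm w) univ (trigPoly N) Q₀ → ‖Q - Q₀‖ ≤ C * lam) ∧
        ∀ lam : ℝ, 0 < lam → ∀ k : Fin (2 * N + 1),
          ‖gramSchmidtBasis (sobolevForm w lam) (modes N) k -
            gramSchmidtBasis (weightedForm w) (modes N) k‖ ≤ C * lam := by
  set C₁ := (N : ℝ) ^ 2 * wp / wm ^ 2
  set C₂ := 2 * (N : ℝ) ^ 2 / (wm * √wm)
  refine ⟨max 1 (max C₁ C₂), lt_max_of_lt_left one_pos, fun w hmeas hbd => ?_⟩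
  have hbelow : ∀ᵐ θ ∂μ₀, wm ≤ w θ := hbd.mono fun _ h => h.1
  have hw : MemLp w ∞ μ₀ := memLp_top_of_bound hmeas wp <| hbd.mono fun θ h => by
    rw [Real.norm_of_nonneg (hwm.le.trans h.1)]
    exact h.2
  refine ⟨existsUnique_isOrthProjector_weightedForm hw hbelow hwm _,
    fun lam hlam => existsUnique_isOrthProjector_sobolevForm hw hbelow hwm hlam.le N,
    fun lam hlam Q Q₀ hQ hQ₀ => ?_, fun lam hlam k => ?_⟩
  · refine (norm_sub_le_of_isOrthProjector_sobolevForm hw hwm hbd hlam.le hQ hQ₀).trans ?_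
    gcongr
    exact (le_max_left _ _).trans (le_max_right _ _)
  · refine (norm_gramSchmidtBasis_sobolevForm_sub_weightedForm_le hw hbelow hwm hlam.le k).trans ?_
    gcongr
    exact (le_max_right _ _).trans (le_max_right _ _)

theorem mainTheorem9 (N : ℕ) (wm wp L : ℝ) (hwm : 0 < wm) :
    ∃ C : ℝ, 0 < C ∧ ∀ w w' : S1Model.S1 → ℝ, S1Model.IsW1Infty w w' →
      (∀ᵐ θ ∂S1Model.μ₀, wm ≤ w θ ∧ w θ ≤ wp) →
      (∀ᵐ θ ∂S1Model.μ₀, |w' θ| ≤ L) →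
        (∃! Q₀ : S1Model.L2 →L[ℂ] S1Model.L2,
          S1Model.IsOrthProjector (S1Model.weightedForm w) Set.univ (S1Model.trigPoly N) Q₀) ∧
        (∀ lam : ℝ, 0 < lam → ∃! Q : S1Model.L2 →L[ℂ] S1Model.L2,
          S1Model.IsOrthProjector (S1Model.sobolevForm w lam) S1Model.H1
            (S1Model.trigPoly N) Q) ∧
        (∀ lam : ℝ, 0 < lam → ∀ Q Q₀ : S1Model.L2 →L[ℂ] S1Model.L2,
          S1Model.IsOrthProjector (S1Model.sobolevForm w lam) S1Model.H1
            (S1Model.trigPoly N) Q →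
          S1Model.IsOrthProjector (S1Model.weightedForm w) Set.univ (S1Model.trigPoly N) Q₀ →
          ‖Q - Q₀‖ ≤ C * lam) ∧
        ∃ U ∈ Matrix.unitaryGroup (Fin (2 * N + 1)) ℂ, ∀ lam : ℝ, 0 < lam →
          ∀ k : Fin (2 * N + 1),
            ‖S1Model.gramSchmidtBasis (S1Model.sobolevForm w lam) (S1Model.modes N) k -
                ∑ j : Fin (2 * N + 1), U k j •
                  S1Model.gramSchmidtBasis (S1Model.weightedForm w) (S1Model.modes N) j‖
              ≤ C * lam := by
  obtain ⟨C, hC, h⟩ := mainTheorem9_general N wm wp hwm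
  refine ⟨C, hC, fun w w' hw hbd _ => ?_⟩
  obtain ⟨hQ₀, hQ, hproj, hbasis⟩ := h w hw.memLp.1 hbd
  exact ⟨hQ₀, hQ, hproj, 1, one_mem _, by simpa [Matrix.one_apply] using hbasis⟩
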